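/- Let $D\ge 1$ be an integer and let $\lambda(dx)=\ell(x)\,dx$ with $\ell(x)=\pi^{-D}e^{-|x|^2}$ be the standard complex Gaussian law on $\mathbb{C}^D\simeq\mathbb{R}^{2D}$, where $dx$ is Lebesgue measure. Let $\Xi$ be a Heisenberg determinantal point process on $\mathbb{C}^D$, that is, a simple point process, almost surely finite on every bounded set, whose $n$-th correlation function with respect to $\lambda$ is, for every $n\ge 1$, $$\rho_n(x_1,\dots,x_n)=\det_{1\le i,j\le n}\big[K(x_i,x_j)\big],\qquad K(x,y)=e^{x\cdot\overline{y}}=\exp\Big(\sum_{l=1}^{D}x^{(l)}\overline{y^{(l)}}\Big).$$ The structure factor of $\Xi$ is $\widehat S(k)=1-e^{-|k|^2/4}$, $k\in\mathbb{R}^{2D}$. Here the structure factor is $\widehat S(k)=1+\widetilde\rho\int_{\mathbb{R}^{2D}}e^{\sqrt{-1}\,k\cdot x}C(x)\,dx$, where the constant $\widetilde\rho$ and the even, integrable and square integrable function $C$ are such that $\rho_1(x)\ell(x)=\widetilde\rho$ and $\rho_2(x,y)\ell(x)\ell(y)=\widetilde\rho^{\,2}(1+C(x-y))$ for all $x,y$.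 For every $R>0$, let $\mathbb{B}^{(2D)}_R=\{x\in\mathbb{C}^D:|x|<R\}$ and let $\Xi(\mathbb{B}^{(2D)}_R)$ be the number of points of $\Xi$ in it. This number is square integrable, and $$\mathbf{E}\big[\Xi(\mathbb{B}^{(2D)}_R)\big]=\frac{R^{2D}}{D!},\qquad \mathrm{Var}\big[\Xi(\mathbb{B}^{(2D)}_R)\big]=\frac{2R^{2D}}{(D-1)!}\int_0^\infty\frac{J_D(\kappa R)^2}{\kappa}\big(1-e^{-\kappa^2/4}\big)\,d\kappa ,$$ where the integral converges absolutely and $J_\nu(z)=(z/2)^\nu\sum_{n=0}^\infty(-1)^n\dfrac{(z/2)^{2n}}{n!\,\Gamma(\nu+n+1)}$ is the Bessel function of the first kind. -/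

import Mathlib

open MeasureTheory ProbabilityTheory Bornology

noncomputable section

/-! ### Configurations and point processes

Throughout, `S` is a metric space with its Borel σ-algebra, and a random measure on `S` is a map
`Ξ : Ω → Measure S` on a probability space `(Ω, P)`. -/

/-- A (locally finite) configuration `ξ = ∑ i, δ_{x i}` on `S`: an at most countable sum of Dirac
measures which is finite on every bounded set. -/
def IsConfiguration {S : Type*} [MetricSpace S] [MeasurableSpace S] (ξ : Measure S) : Prop :=
  (∃ (I : Set ℕ) (x : ℕ → S), ξ = Measure.sum (fun i : I => Measure.dirac (x i))) ∧
    ∀ Λ : Set S, IsBounded Λ → ξ Λ < ⊤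

/-- A point process: a random configuration, measurable for the σ-algebra on `Measure S` generated
by the maps `ξ ↦ ξ Λ`, `Λ` measurable. -/
structure IsPointProcess {Ω S : Type*} [MeasurableSpace Ω] [MetricSpace S] [MeasurableSpace S]
    (P : Measure Ω) (Ξ : Ω → Measure S) : Prop where
  measurable : Measurable Ξ
  isConfiguration : ∀ᵐ ω ∂P, IsConfiguration (Ξ ω)

/-- A point process is simple if almost surely no point is occupied more than once. -/
def IsSimplePointProcess {Ω S : Type*} [MeasurableSpace Ω] [MetricSpace S] [MeasurableSpace S]
    (P : Measure Ω) (Ξ : Ω → Measure S) : Prop :=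
  IsPointProcess P Ξ ∧ ∀ᵐ ω ∂P, ∀ x : S, Ξ ω {x} = 0 ∨ Ξ ω {x} = 1

/-! ### Correlation functions -/

/-- The index set of the points of a configuration `ξ`, counted with multiplicity: a site `x` of
multiplicity `ξ {x} = m` contributes the indices `(x, 0), …, (x, m - 1)`. -/
def PointIndex {S : Type*} [MeasurableSpace S] (ξ : Measure S) : Type _ :=
  {p : S × ℕ // (p.2 : ENNReal) < ξ {p.1}}

/-- The measure `ξ_n = ∑ δ_{(x_{i_1}, …, x_{i_n})}` on `S ^ n`, the sum being over all `n`-tuples of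
pairwise distinct indices of points of `ξ`. -/
def factorialMeasure {S : Type*} [MeasurableSpace S] (ξ : Measure S) (n : ℕ) :
    Measure (Fin n → S) :=
  Measure.sum (fun i : {i : Fin n → PointIndex ξ // Function.Injective i} =>
    Measure.dirac (fun j => (i.1 j).1.1))

/-- Bounded measurable complex functions of compact support. -/
structure IsBoundedCompactlySupported {X : Type*} [TopologicalSpace X] [MeasurableSpace X]
    (φ : X → ℂ) : Prop where
  measurable : Measurable φ
  bounded : ∃ M : ℝ, ∀ x, ‖φ x‖ ≤ M
  hasCompactSupport : HasCompactSupport φ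

/-- `ρ` is the `n`-th correlation function of `Ξ` with respect to the reference measure `lam`:
`E ⟨Ξ_n, φ⟩ = ∫ φ ρ d lam^{⊗ n}` for all bounded measurable compactly supported `φ` on `S ^ n`.
The existence of both sides is part of the definition. -/
structure IsCorrelationFunction {Ω S : Type*} [MeasurableSpace Ω] [MetricSpace S]
    [MeasurableSpace S] (P : Measure Ω) (Ξ : Ω → Measure S) (lam : Measure S) (n : ℕ)
    (ρ : (Fin n → S) → ℝ) : Prop where
  measurable : Measurable ρ
  nonneg : ∀ x, 0 ≤ ρ x
  symmetric : ∀ (σ : Equiv.Perm (Fin n)) (x : Fin n → S), ρ (x ∘ σ) = ρ x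
  integrable_left : ∀ φ : (Fin n → S) → ℂ, IsBoundedCompactlySupported φ →
    Integrable (fun ω => ∫ x, φ x ∂(factorialMeasure (Ξ ω) n)) P
  integrable_right : ∀ φ : (Fin n → S) → ℂ, IsBoundedCompactlySupported φ →
    Integrable (fun x => φ x * (ρ x : ℂ)) (Measure.pi (fun _ : Fin n => lam))
  integral_eq : ∀ φ : (Fin n → S) → ℂ, IsBoundedCompactlySupported φ →
    ∫ ω, (∫ x, φ x ∂(factorialMeasure (Ξ ω) n)) ∂P =
      ∫ x, φ x * (ρ x : ℂ) ∂(Measure.pi (fun _ : Fin n => lam))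

/-- The triplet `(Ξ, K, lam)` is a determinantal point process: `Ξ` is a simple point process whose
`n`-th correlation function with respect to `lam` is `det [K (x i) (x j)]`, for every `n ≥ 1`. -/
structure IsDPP {Ω S : Type*} [MeasurableSpace Ω] [MetricSpace S] [MeasurableSpace S]
    (P : Measure Ω) (Ξ : Ω → Measure S) (K : S → S → ℂ) (lam : Measure S) : Prop where
  simple : IsSimplePointProcess P Ξ
  measurable_kernel : Measurable (Function.uncurry K)
  correlation : ∀ n : ℕ, 1 ≤ n → ∃ ρ : (Fin n → S) → ℝ,
    IsCorrelationFunction P Ξ lam n ρ ∧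
      ∀ x : Fin n → S, (ρ x : ℂ) = Matrix.det (Matrix.of fun i j => K (x i) (x j))

/-! ### Structure factor -/

/-- `Shat` is the structure factor of the translation invariant point process `Ξ` on `E ≃ ℝ^d`
with reference measure `ℓ(x) dx`. That is, the first two correlation functions satisfy
`ρ₁(x) ℓ(x) = ρt` (a constant) and `ρ₂(x, y) ℓ(x) ℓ(y) = ρt² (1 + C(x - y))` with `C` even,
measurable, integrable and square integrable (the total correlation function), and
`Shat(k) = 1 + ρt ∫ e^{i k · x} C(x) dx`. -/
def HasStructureFactor {Ω E : Type*} [MeasurableSpace Ω] [NormedAddCommGroup E]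
    [InnerProductSpace ℝ E] [FiniteDimensional ℝ E] [MeasurableSpace E] [BorelSpace E]
    (P : Measure Ω) (Ξ : Ω → Measure E) (ℓ : E → ℝ) (Shat : E → ℂ) : Prop :=
  ∃ (ρ₁ : (Fin 1 → E) → ℝ) (ρ₂ : (Fin 2 → E) → ℝ) (ρt : ℝ) (C : E → ℝ),
    IsCorrelationFunction P Ξ (volume.withDensity fun x => ENNReal.ofReal (ℓ x)) 1 ρ₁ ∧
    IsCorrelationFunction P Ξ (volume.withDensity fun x => ENNReal.ofReal (ℓ x)) 2 ρ₂ ∧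
    (∀ x, ρ₁ ![x] * ℓ x = ρt) ∧
    (∀ x y, ρ₂ ![x, y] * ℓ x * ℓ y = ρt ^ 2 * (1 + C (x - y))) ∧
    Measurable C ∧ (∀ x, C (-x) = C x) ∧ Integrable C ∧ MemLp C 2 ∧
    ∀ k, Shat k = 1 + (ρt : ℂ) *
      ∫ x, Complex.exp (Complex.I * ((inner ℝ k x : ℝ) : ℂ)) * (C x : ℂ)

/-! ### The Heisenberg family -/

/-- The density `e^{-|x|²} / π^D` of the standard complex Gaussian law on `ℂ^D`. -/
def gaussianDensity (D : ℕ) (x : EuclideanSpace ℂ (Fin D)) : ℝ :=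
  Real.exp (-‖x‖ ^ 2) / Real.pi ^ D

/-- The standard complex Gaussian law `e^{-|x|²} / π^D dx` on `ℂ^D`; here `volume` is Lebesgue
measure on `ℂ^D ≃ ℝ^{2D}`. -/
def complexGaussian (D : ℕ) : Measure (EuclideanSpace ℂ (Fin D)) :=
  volume.withDensity fun x => ENNReal.ofReal (gaussianDensity D x)

/-- The kernel `e^{x · ȳ}` on `ℂ^D`. -/
def heisenbergKernel (D : ℕ) (x y : EuclideanSpace ℂ (Fin D)) : ℂ :=
  Complex.exp (∑ i, x i * (starRingEnd ℂ) (y i))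

/-- `Ξ` is the Heisenberg determinantal point process on `ℂ^D`. -/
def IsHeisenbergDPP {Ω : Type*} [MeasurableSpace Ω] (P : Measure Ω) (D : ℕ)
    (Ξ : Ω → Measure (EuclideanSpace ℂ (Fin D))) : Prop :=
  IsDPP P Ξ (heisenbergKernel D) (complexGaussian D)

/-- The Bessel function of the first kind, of real order `ν`, at `x > 0`. -/
def besselJ (ν x : ℝ) : ℝ :=
  (x / 2) ^ ν * ∑' n : ℕ, (-1) ^ n * (x / 2) ^ (2 * n) / (n.factorial * Real.Gamma (ν + n + 1))

end

/-! ### Moments of linear forms under an even-dimensional Gaussian -/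

section GaussianMoments

variable {E : Type*} [NormedAddCommGroup E] [InnerProductSpace ℝ E] [FiniteDimensional ℝ E]
  [MeasurableSpace E] [BorelSpace E]

/-! Only two correlation functions matter. Since `|K(x,y)|² = exp(|x|² + |y|² - |x-y|²)`, the
Gaussian densities cancel and leave the intensities `π^(-D)` and `π^(-2D) (1 - exp(-|x-y|²))`. Thus
`C(x) = -exp(-|x|²)`, whose Fourier transform gives the structure factor.

For the count `N` in a ball `B` of volume `V`, the first two factorial moments
(`IsCorrelationFunction.factorial_moment`) give `E N = V/π^D` and `Var N = V/π^D - π^(-2D) ∬_{B×B}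
exp(-|x-y|²)`. Let `F` be the Fourier transform of the indicator of `B`. Plancherel turns the first
term into `∫ |F|²`, and `integral_gaussian_mul_ballFourier` turns the second into `∫ exp(-|k|²/4)
|F|²`. Hence `Var N` is a constant times `∫ |F(k)|² (1 - exp(-|k|²/4)) dk`, and polar coordinates
reduce this to the Bessel integral.

Two analytic facts are proved by hand from Gaussians. The formula `F(k) = (2πR/|k|)^D J_D(|k|R)`
comes from the moments of linear forms on the ball, obtained by viewing the Gaussian as a mixture of
balls (`integral_inner_pow_gaussianWeight_eq_ball`). Plancherel for `B` comes from inserting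
`exp(-b|k|²)` and letting `b → 0`. -/

theorem integral_cexp_gaussian_of_even_dim {d : ℕ} (hd : Module.finrank ℝ E = 2 * d) {b : ℝ}
    (hb : 0 < b) (c : ℂ) (w : E) :
    ∫ v : E, Complex.exp (-b * ‖v‖ ^ 2 + c * (inner ℝ w v : ℝ)) =
      (Real.pi / b) ^ d * Complex.exp (c ^ 2 * ‖w‖ ^ 2 / (4 * b)) := by
  rw [GaussianFourier.integral_cexp_neg_mul_sq_norm_add (by simpa using hb), hd]
  congr 1
  rw [show (((2 * d : ℕ) : ℂ) / 2) = (d : ℂ) by push_cast; ring, Complex.cpow_natCast]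

theorem integrable_exp_gaussian {b : ℝ} (hb : 0 < b) (c : ℝ) (w : E) :
    Integrable (fun v : E => Real.exp (-b * ‖v‖ ^ 2 + c * inner ℝ w v)) := by
  have h := (GaussianFourier.integrable_cexp_neg_mul_sq_norm_add (b := (b : ℂ)) (V := E)
    (by simpa using hb) (c : ℂ) w).re
  refine h.congr (Filter.Eventually.of_forall fun v => ?_)
  simp only [RCLike.re_eq_complex_re]
  rw [← Complex.ofReal_re (Real.exp _)]
  push_cast
  rfl

theorem integral_exp_gaussian_of_even_dim {d : ℕ} (hd : Module.finrank ℝ E = 2 * d) {b : ℝ}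
    (hb : 0 < b) (c : ℝ) (w : E) :
    ∫ v : E, Real.exp (-b * ‖v‖ ^ 2 + c * inner ℝ w v) =
      (Real.pi / b) ^ d * Real.exp (c ^ 2 * ‖w‖ ^ 2 / (4 * b)) := by
  have h := integral_cexp_gaussian_of_even_dim hd hb (c : ℂ) w
  have h2 : ∫ v : E, Complex.exp (-b * ‖v‖ ^ 2 + c * (inner ℝ w v : ℝ)) =
      ((∫ v : E, Real.exp (-b * ‖v‖ ^ 2 + c * inner ℝ w v) : ℝ) : ℂ) := by
    rw [← integral_complex_ofReal]
    push_cast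
    rfl
  rw [h2] at h
  exact_mod_cast h

/-- The unnormalised Gaussian measure `exp (-‖x‖²) dx`. -/
noncomputable def gaussianWeight (E : Type*) [NormedAddCommGroup E] [InnerProductSpace ℝ E]
    [FiniteDimensional ℝ E] [MeasurableSpace E] [BorelSpace E] : Measure E :=
  volume.withDensity fun x => ENNReal.ofReal (Real.exp (-‖x‖ ^ 2))

theorem integral_gaussianWeight (f : E → ℝ) :
    ∫ x, f x ∂(gaussianWeight E) = ∫ x, Real.exp (-‖x‖ ^ 2) * f x := by
  rw [gaussianWeight, integral_withDensity_eq_integral_toReal_smul (by fun_prop) (by simp)]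
  simp [ENNReal.toReal_ofReal, Real.exp_nonneg]

theorem integrable_gaussianWeight_iff {f : E → ℝ} :
    Integrable f (gaussianWeight E) ↔ Integrable (fun x => Real.exp (-‖x‖ ^ 2) * f x) := by
  rw [gaussianWeight, integrable_withDensity_iff_integrable_smul' (by fun_prop) (by simp)]
  simp [ENNReal.toReal_ofReal, Real.exp_nonneg]

/-- Makes `0` an interior point, which yields all polynomial moments and the analyticity of the
moment generating function at `0`. -/
theorem integrableExpSet_gaussianWeight (w : E) :
    integrableExpSet (fun x => inner ℝ w x) (gaussianWeight E) = Set.univ := by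
  ext t
  simp only [integrableExpSet, Set.mem_ofPred_eq, Set.mem_univ, iff_true,
    integrable_gaussianWeight_iff, ← Real.exp_add]
  simpa using integrable_exp_gaussian one_pos t w

theorem integrable_inner_pow_gaussianWeight (w : E) (n : ℕ) :
    Integrable (fun x => inner ℝ w x ^ n) (gaussianWeight E) :=
  integrable_pow_of_mem_interior_integrableExpSet
    (by simp [integrableExpSet_gaussianWeight]) n

instance : IsFiniteMeasure (gaussianWeight E) := by
  rw [← integrable_const_iff_isFiniteMeasure (one_ne_zero (α := ℝ))]
  simpa using integrable_inner_pow_gaussianWeight (0 : E) 0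

theorem mgf_gaussianWeight {d : ℕ} (hd : Module.finrank ℝ E = 2 * d) (w : E) (t : ℝ) :
    mgf (fun x => inner ℝ w x) (gaussianWeight E) t =
      Real.pi ^ d * Real.exp (t ^ 2 * (‖w‖ ^ 2 / 4)) := by
  rw [mgf, integral_gaussianWeight]
  simp only [← Real.exp_add]
  have := integral_exp_gaussian_of_even_dim hd one_pos t w
  simp only [div_one, mul_one, neg_mul, one_mul] at this
  rw [this, mul_div_assoc]

/-- The Taylor coefficients at `0` of `t ↦ exp (t² s)`. -/
noncomputable def expSqCoeff (s : ℝ) (n : ℕ) : ℝ :=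
  if Even n then s ^ (n / 2) / (n / 2).factorial else 0

theorem hasSum_expSqCoeff (s t : ℝ) :
    HasSum (fun n => t ^ n * expSqCoeff s n) (Real.exp (t ^ 2 * s)) := by
  have hinj : Function.Injective (fun m : ℕ => 2 * m) := fun a b h => by simpa using h
  -- The odd coefficients vanish, so the sum lives on the range of `m ↦ 2 * m`.
  rw [← hinj.hasSum_iff]
  · rw [Real.exp_eq_exp_ℝ]
    refine (NormedSpace.expSeries_div_hasSum_exp (t ^ 2 * s)).congr_fun ?_
    intro m
    simp [expSqCoeff, mul_pow, pow_mul, mul_div_assoc]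
  · intro n hn
    have : ¬ Even n := fun ⟨m, hm⟩ => hn ⟨m, by simp [hm, two_mul]⟩
    simp [expSqCoeff, this]

/-- The moment generating function has two power series at `0`: one with the moments over `n!`, one
from the closed form `π^d exp(t²‖w‖²/4)`. Uniqueness of coefficients identifies them. -/
theorem integral_inner_pow_gaussianWeight {d : ℕ} (hd : Module.finrank ℝ E = 2 * d) (w : E)
    (n : ℕ) :
    ∫ x, inner ℝ w x ^ n ∂(gaussianWeight E) =
      n.factorial * (Real.pi ^ d * expSqCoeff (‖w‖ ^ 2 / 4) n) := by
  have h1 := hasFPowerSeriesAt_mgf (X := fun x => inner ℝ w x) (μ := gaussianWeight E) (v := 0)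
    (by simp [integrableExpSet_gaussianWeight])
  have h2 : HasFPowerSeriesAt (mgf (fun x => inner ℝ w x) (gaussianWeight E))
      (FormalMultilinearSeries.ofScalars ℝ
        fun n => Real.pi ^ d * expSqCoeff (‖w‖ ^ 2 / 4) n) 0 := by
    rw [hasFPowerSeriesAt_iff]
    refine Filter.Eventually.of_forall fun t => ?_
    rw [zero_add, mgf_gaussianWeight hd]
    refine ((hasSum_expSqCoeff (‖w‖ ^ 2 / 4) t).mul_left (Real.pi ^ d)).congr_fun ?_
    intro n
    simp only [FormalMultilinearSeries.coeff_ofScalars, smul_eq_mul]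
    ring
  have h3 := congrFun (FormalMultilinearSeries.ofScalars_series_injective ℝ ℝ
    (h1.eq_formalMultilinearSeries h2)) n
  simp only [zero_mul, Real.exp_zero, mul_one] at h3
  rw [← h3, mul_div_cancel₀ _ (by positivity)]

end GaussianMoments

/-! ### Fourier transform of a ball as a Bessel function -/

section BallFourier

variable {E : Type*} [NormedAddCommGroup E] [InnerProductSpace ℝ E] [FiniteDimensional ℝ E]
  [MeasurableSpace E] [BorelSpace E]

theorem setIntegral_ball_inner_pow (w : E) (n : ℕ) {R : ℝ} (hR : 0 < R) :
    ∫ x in Metric.ball (0 : E) R, inner ℝ w x ^ n =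
      R ^ (n + Module.finrank ℝ E) * ∫ x in Metric.ball (0 : E) 1, inner ℝ w x ^ n := by
  have h := Measure.setIntegral_comp_smul (volume : Measure E) (fun x => inner ℝ w x ^ n)
    (Metric.ball (0 : E) 1) hR.ne'
  rw [smul_unitBall_of_pos hR, abs_of_pos (by positivity)] at h
  simp only [inner_smul_right, mul_pow, integral_const_mul, smul_eq_mul] at h
  rw [pow_add, mul_right_comm, h]
  field_simp

/-- With `a = ‖x‖`, this presents the Gaussian as a superposition of indicators of the balls `‖x‖ <
r`. -/
theorem integral_Ioi_two_mul_exp_neg_sq (a : ℝ) :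
    ∫ r in Set.Ioi a, 2 * r * Real.exp (-r ^ 2) = Real.exp (-a ^ 2) := by
  have hd : ∀ x ∈ Set.Ici a, HasDerivAt (fun r : ℝ => -Real.exp (-r ^ 2))
      (2 * x * Real.exp (-x ^ 2)) x := by
    intro x _
    have := ((hasDerivAt_pow 2 x).neg.exp).neg
    refine this.congr_deriv ?_
    simp; ring
  have hlim : Filter.Tendsto (fun r : ℝ => -Real.exp (-r ^ 2)) Filter.atTop (nhds 0) := by
    rw [← neg_zero]
    exact (Real.tendsto_exp_neg_atTop_nhds_zero.comp (Filter.tendsto_pow_atTop two_ne_zero)).neg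
  have hi : Integrable (fun r : ℝ => 2 * r * Real.exp (-r ^ 2)) := by
    have := (integrable_mul_exp_neg_mul_sq (b := 1) one_pos).const_mul 2
    simpa [mul_assoc] using this
  rw [integral_Ioi_of_hasDerivAt_of_tendsto' hd hi.integrableOn hlim]
  simp

theorem integral_Ioi_two_mul_pow_mul_exp_neg_sq (n : ℕ) :
    ∫ r in Set.Ioi (0 : ℝ), 2 * r * Real.exp (-r ^ 2) * r ^ n = Real.Gamma (n / 2 + 1) := by
  have h := integral_rpow_mul_exp_neg_mul_rpow (p := 2) (q := n + 1) (b := 1) two_pos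
    (by linarith [(Nat.cast_nonneg n : (0 : ℝ) ≤ n)]) one_pos
  rw [Real.one_rpow, one_mul] at h
  have h2 : ∫ r in Set.Ioi (0 : ℝ), 2 * r * Real.exp (-r ^ 2) * r ^ n =
      ∫ r in Set.Ioi (0 : ℝ), 2 * (r ^ ((n : ℝ) + 1) * Real.exp (-1 * r ^ (2 : ℝ))) := by
    refine setIntegral_congr_fun measurableSet_Ioi fun r hr => ?_
    have : r ^ ((n : ℝ) + 1) = r ^ (n + 1) := by
      rw [← Real.rpow_natCast]; push_cast; rfl
    simp only [this, Real.rpow_two, neg_mul, one_mul]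
    ring
  rw [h2, integral_const_mul, h, ← mul_assoc]
  norm_num
  congr 1
  ring

/-- Layer-cake argument: write the Gaussian as a mixture of balls, swap the integrals, and scale
each ball to radius one. The remaining radial integral is the Gamma factor. -/
theorem integral_inner_pow_gaussianWeight_eq_ball (w : E) (n : ℕ) :
    ∫ x, inner ℝ w x ^ n ∂(gaussianWeight E) =
      Real.Gamma ((n + Module.finrank ℝ E : ℕ) / 2 + 1) *
        ∫ x in Metric.ball (0 : E) 1, inner ℝ w x ^ n := by
  set h : E → ℝ := fun x => inner ℝ w x ^ n with hh
  have hint : Integrable (fun x => Real.exp (-‖x‖ ^ 2) * h x) :=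
    integrable_gaussianWeight_iff.1 (integrable_inner_pow_gaussianWeight w n)
  set G : E → ℝ → ℝ := fun x r => if ‖x‖ < r then 2 * r * Real.exp (-r ^ 2) * h x else 0 with hG
  have hGmeas : Measurable (Function.uncurry G) := by
    refine Measurable.ite (measurableSet_lt (by fun_prop) (by fun_prop)) ?_ measurable_const
    exact Continuous.measurable (by fun_prop)
  have hGind : ∀ x, G x = (Set.Ioi ‖x‖).indicator
      (fun r => 2 * r * Real.exp (-r ^ 2) * h x) := by
    intro x; ext r; simp [hG, Set.indicator_apply]
  have hi : Integrable (fun r : ℝ => 2 * r * Real.exp (-r ^ 2)) := by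
    have := (integrable_mul_exp_neg_mul_sq (b := 1) one_pos).const_mul 2
    simpa [mul_assoc] using this
  have hGint : ∀ x, ∫ r, G x r = Real.exp (-‖x‖ ^ 2) * h x := by
    intro x
    rw [hGind, integral_indicator measurableSet_Ioi, integral_mul_const,
      integral_Ioi_two_mul_exp_neg_sq]
  have hGnorm : ∀ x, ∫ r, ‖G x r‖ = Real.exp (-‖x‖ ^ 2) * ‖h x‖ := by
    intro x
    rw [hGind]
    simp only [norm_indicator_eq_indicator_norm]
    rw [integral_indicator measurableSet_Ioi, ← integral_Ioi_two_mul_exp_neg_sq,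
      ← integral_mul_const]
    refine setIntegral_congr_fun measurableSet_Ioi fun r hr => ?_
    have : 0 < r := (norm_nonneg x).trans_lt hr
    simp [abs_of_pos this]
  have hprod : Integrable (Function.uncurry G) ((volume : Measure E).prod volume) := by
    rw [integrable_prod_iff hGmeas.aestronglyMeasurable]
    refine ⟨Filter.Eventually.of_forall fun x => ?_, ?_⟩
    · change Integrable (G x)
      rw [hGind]
      exact (hi.mul_const _).indicator measurableSet_Ioi
    · simp only [Function.uncurry_apply_pair, hGnorm]
      refine hint.norm.congr (Filter.Eventually.of_forall fun x => ?_)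
      simp
  have hswap := integral_integral_swap hprod
  simp only [hGint] at hswap
  rw [integral_gaussianWeight, hswap, ← integral_Ioi_two_mul_pow_mul_exp_neg_sq,
    ← integral_mul_const, ← integral_indicator measurableSet_Ioi]
  congr 1
  ext r
  by_cases hr : 0 < r
  · have : (fun x => G x r) = (Metric.ball (0 : E) r).indicator
        (fun x => 2 * r * Real.exp (-r ^ 2) * h x) := by
      ext x
      by_cases hx : ‖x‖ < r <;> simp [hG, hx]
    rw [this, integral_indicator Metric.isOpen_ball.measurableSet, integral_const_mul,
      Set.indicator_of_mem (show r ∈ Set.Ioi (0 : ℝ) from hr), setIntegral_ball_inner_pow w n hr]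
    ring
  · have : (fun x => G x r) = 0 := by
      ext x
      have : ¬ ‖x‖ < r := fun hx => hr ((norm_nonneg x).trans_lt hx)
      simp [hG, this]
    rw [this, Set.indicator_of_notMem (by simpa using hr)]
    simp

/-- Even and odd moments of the uniform measure on an even-dimensional ball. -/
theorem setIntegral_ball_inner_pow_of_even_dim {d : ℕ} (hd : Module.finrank ℝ E = 2 * d) (w : E)
    (n : ℕ) {R : ℝ} (hR : 0 < R) :
    ∫ x in Metric.ball (0 : E) R, inner ℝ w x ^ n =
      R ^ (n + 2 * d) * (n.factorial * (Real.pi ^ d * expSqCoeff (‖w‖ ^ 2 / 4) n)) /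
        Real.Gamma (n / 2 + d + 1) := by
  -- The Gaussian moment is now known in two ways; dividing by the positive Gamma factor isolates
  -- the moment of the unit ball.
  have h := integral_inner_pow_gaussianWeight_eq_ball w n
  rw [integral_inner_pow_gaussianWeight hd, hd] at h
  have hg : 0 < Real.Gamma ((n : ℝ) / 2 + d + 1) := Real.Gamma_pos_of_pos (by positivity)
  rw [setIntegral_ball_inner_pow w n hR, hd, h]
  push_cast
  rw [show ((n : ℝ) + 2 * d) / 2 + 1 = n / 2 + d + 1 by ring]
  field_simp

/-- The Fourier transform of the indicator function of the ball of radius `R`. -/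
noncomputable def ballFourier (R : ℝ) (k : E) : ℂ :=
  ∫ x in Metric.ball (0 : E) R, Complex.exp (Complex.I * (inner ℝ k x : ℝ))

/-- Termwise integration of the exponential series, dominated by `exp |⟪k, x⟫|`, which is integrable
on the bounded ball. -/
theorem hasSum_ballFourier (R : ℝ) (k : E) :
    HasSum (fun n : ℕ => Complex.I ^ n / n.factorial *
      ((∫ x in Metric.ball (0 : E) R, inner ℝ k x ^ n : ℝ) : ℂ)) (ballFourier R k) := by
  have hfin : IsFiniteMeasure (volume.restrict (Metric.ball (0 : E) R)) :=
    ⟨by simpa using measure_ball_lt_top⟩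
  have key : HasSum (fun n : ℕ => ∫ x in Metric.ball (0 : E) R,
      (Complex.I * (inner ℝ k x : ℝ)) ^ n / (n.factorial : ℂ)) (ballFourier R k) := by
    refine hasSum_integral_of_dominated_convergence
      (fun n x => |inner ℝ k x| ^ n / n.factorial)
      (fun n => Continuous.aestronglyMeasurable (by fun_prop)) (fun n => ?_) ?_ ?_ ?_
    · exact Filter.Eventually.of_forall fun x => by simp
    · exact Filter.Eventually.of_forall fun x => Real.summable_pow_div_factorial _
    · have : (fun x : E => ∑' n : ℕ, |inner ℝ k x| ^ n / (n.factorial : ℝ)) =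
          fun x => Real.exp |inner ℝ k x| := by
        ext x
        rw [Real.exp_eq_exp_ℝ]
        exact (NormedSpace.expSeries_div_hasSum_exp (|inner ℝ k x| : ℝ)).tsum_eq
      rw [this]
      refine ((by fun_prop : Continuous fun x : E => Real.exp |inner ℝ k x|).continuousOn
        |>.integrableOn_compact (isCompact_closedBall (0 : E) R)).mono_set
        Metric.ball_subset_closedBall
    · refine Filter.Eventually.of_forall fun x => ?_
      rw [Complex.exp_eq_exp_ℂ]
      exact NormedSpace.expSeries_div_hasSum_exp _
  refine key.congr_fun fun n => ?_
  rw [← integral_complex_ofReal, ← integral_const_mul]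
  congr 1
  ext x
  push_cast
  ring

/-- Odd moments vanish; in the even ones `(2m)!` cancels and the Bessel series remains. Nonzero `k`
is needed for `(2/(‖k‖R))^d` to cancel the prefactor of `besselJ`. -/
theorem ballFourier_eq_besselJ {d : ℕ} (hd : Module.finrank ℝ E = 2 * d) {R : ℝ} (hR : 0 < R)
    {k : E} (hk : k ≠ 0) :
    ballFourier R k =
      ((Real.pi ^ d * R ^ (2 * d) * (2 / (‖k‖ * R)) ^ d * besselJ d (‖k‖ * R) : ℝ) : ℂ) := by
  have hk' : 0 < ‖k‖ := norm_pos_iff.2 hk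
  have h := hasSum_ballFourier R k
  have hinj : Function.Injective (fun m : ℕ => 2 * m) := fun a b h => by simpa using h
  rw [← hinj.hasSum_iff] at h
  · rw [← h.tsum_eq, besselJ, Real.rpow_natCast]
    have e : Real.pi ^ d * R ^ (2 * d) * (2 / (‖k‖ * R)) ^ d * ((‖k‖ * R / 2) ^ d *
        ∑' n : ℕ, (-1) ^ n * (‖k‖ * R / 2) ^ (2 * n) /
          (n.factorial * Real.Gamma ((d : ℝ) + n + 1))) =
        Real.pi ^ d * R ^ (2 * d) * ∑' n : ℕ, (-1) ^ n * (‖k‖ * R / 2) ^ (2 * n) /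
          (n.factorial * Real.Gamma ((d : ℝ) + n + 1)) := by
      have : (2 / (‖k‖ * R)) ^ d * (‖k‖ * R / 2) ^ d = 1 := by
        rw [← mul_pow, div_mul_div_comm, mul_comm 2, div_self (by positivity), one_pow]
      rw [mul_assoc _ ((2 / (‖k‖ * R)) ^ d), ← mul_assoc ((2 / (‖k‖ * R)) ^ d), this, one_mul]
    rw [e, ← tsum_mul_left, Complex.ofReal_tsum]
    congr 1
    ext m
    simp only [Function.comp]
    rw [setIntegral_ball_inner_pow_of_even_dim hd k _ hR, pow_mul, Complex.I_sq, expSqCoeff,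
      if_pos (even_two_mul m), Nat.mul_div_cancel_left _ two_pos]
    have hg : Real.Gamma ((d : ℝ) + m + 1) ≠ 0 := (Real.Gamma_pos_of_pos (by positivity)).ne'
    have hg2 : ((2 * m : ℕ) : ℝ) / 2 + d + 1 = d + m + 1 := by push_cast; ring
    rw [hg2]
    have : ((-1 : ℂ)) = ((-1 : ℝ) : ℂ) := by simp
    rw [this, ← Complex.ofReal_natCast, ← Complex.ofReal_pow, ← Complex.ofReal_div,
      ← Complex.ofReal_mul]
    congr 1
    have hf : (((2 * m).factorial : ℕ) : ℝ) ≠ 0 := by exact_mod_cast (2 * m).factorial_ne_zero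
    have hf' : ((m.factorial : ℕ) : ℝ) ≠ 0 := by exact_mod_cast m.factorial_ne_zero
    have hp : (‖k‖ ^ 2 / 4) ^ m * R ^ (2 * m) = (‖k‖ * R / 2) ^ (2 * m) := by
      rw [pow_mul R, ← mul_pow, pow_mul]
      congr 1
      ring
    rw [pow_add, ← hp]
    field_simp
  · intro n hn
    have : ¬ Even n := fun ⟨m, hm⟩ => hn ⟨m, by simp [hm, two_mul]⟩
    rw [setIntegral_ball_inner_pow_of_even_dim hd k _ hR, expSqCoeff, if_neg this]
    simp

end BallFourier

/-! ### Gaussian-weighted and plain Plancherel identities for a ball -/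

section BallPlancherel

variable {E : Type*} [NormedAddCommGroup E] [InnerProductSpace ℝ E] [FiniteDimensional ℝ E]
  [MeasurableSpace E] [BorelSpace E]

/-- Lebesgue measure on the ball of radius `R`. -/
noncomputable def ballMeasure (E : Type*) [NormedAddCommGroup E] [InnerProductSpace ℝ E]
    [FiniteDimensional ℝ E] [MeasurableSpace E] [BorelSpace E] (R : ℝ) : Measure E :=
  volume.restrict (Metric.ball (0 : E) R)

instance (R : ℝ) : IsFiniteMeasure (ballMeasure E R) :=
  ⟨by simpa [ballMeasure] using measure_ball_lt_top⟩

theorem ballFourier_mul_conj (R : ℝ) (k : E) :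
    ((‖ballFourier R k‖ ^ 2 : ℝ) : ℂ) = ∫ p, Complex.exp (Complex.I * (inner ℝ (p.1 - p.2) k : ℝ))
      ∂((ballMeasure E R).prod (ballMeasure E R)) := by
  have h : ∀ p : E × E, Complex.exp (Complex.I * (inner ℝ (p.1 - p.2) k : ℝ)) =
      Complex.exp (Complex.I * (inner ℝ k p.1 : ℝ)) *
        (starRingEnd ℂ) (Complex.exp (Complex.I * (inner ℝ k p.2 : ℝ))) := by
    intro p
    rw [← Complex.exp_conj, ← Complex.exp_add, inner_sub_left, real_inner_comm k, real_inner_comm k]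
    congr 1
    simp
    ring
  simp only [h]
  rw [integral_prod_mul (fun x : E => Complex.exp (Complex.I * (inner ℝ k x : ℝ)))
    (fun x : E => (starRingEnd ℂ) (Complex.exp (Complex.I * (inner ℝ k x : ℝ)))), integral_conj]
  change _ = ballFourier R k * (starRingEnd ℂ) (ballFourier R k)
  rw [Complex.mul_conj, Complex.normSq_eq_norm_sq]

/-- Licenses Fubini: the modulus is a Gaussian in `k` alone, and the ball has finite measure. -/
theorem integrable_gaussian_mul_cexp_inner (R : ℝ) {b : ℝ} (hb : 0 < b) :
    Integrable (Function.uncurry fun (k : E) (p : E × E) =>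
      Complex.exp (-b * ‖k‖ ^ 2 + Complex.I * (inner ℝ (p.1 - p.2) k : ℝ)))
      (volume.prod ((ballMeasure E R).prod (ballMeasure E R))) := by
  have h1 : Integrable (fun k : E => Real.exp (-b * ‖k‖ ^ 2)) := by
    simpa using integrable_exp_gaussian hb 0 (0 : E)
  have h2 := h1.mul_prod (integrable_const (1 : ℝ)
    (μ := (ballMeasure E R).prod (ballMeasure E R)))
  refine h2.mono' (Continuous.aestronglyMeasurable (by fun_prop))
    (Filter.Eventually.of_forall fun z => le_of_eq ?_)
  simp [Function.uncurry, Complex.norm_exp, ← Complex.ofReal_pow]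

theorem integrable_gaussian_mul_ballFourier (R : ℝ) {b : ℝ} (hb : 0 < b) :
    Integrable fun k : E => Real.exp (-b * ‖k‖ ^ 2) * ‖ballFourier R k‖ ^ 2 := by
  have h := (integrable_gaussian_mul_cexp_inner (E := E) R hb).integral_prod_left.re
  refine h.congr (Filter.Eventually.of_forall fun k => ?_)
  simp only [Function.uncurry_apply_pair, Complex.exp_add, integral_const_mul,
    ← ballFourier_mul_conj]
  rw [RCLike.re_eq_complex_re, ← Complex.ofReal_re (Real.exp _ * _)]
  push_cast
  rfl

/-- Expand `|F|²` as a double integral and integrate over `k` first. It serves twice: `b = 1/4`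
produces exactly `exp(-‖x-y‖²)`, and `b → 0` produces Plancherel. -/
theorem integral_gaussian_mul_ballFourier {d : ℕ} (hd : Module.finrank ℝ E = 2 * d) (R : ℝ)
    {b : ℝ} (hb : 0 < b) :
    ∫ k : E, Real.exp (-b * ‖k‖ ^ 2) * ‖ballFourier R k‖ ^ 2 =
      (Real.pi / b) ^ d * ∫ p, Real.exp (-‖p.1 - p.2‖ ^ 2 / (4 * b))
        ∂((ballMeasure E R).prod (ballMeasure E R)) := by
  have h := integral_integral_swap (integrable_gaussian_mul_cexp_inner (E := E) R hb)
  simp only [integral_cexp_gaussian_of_even_dim hd hb, integral_const_mul] at h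
  simp only [Complex.exp_add, integral_const_mul, ← ballFourier_mul_conj, Complex.I_sq] at h
  rw [← Complex.ofReal_inj, ← integral_complex_ofReal, Complex.ofReal_mul,
    ← integral_complex_ofReal]
  push_cast at h ⊢
  rw [h]
  simp

/-- Rescaling of the Gaussian double integral over the ball. -/
theorem integral_exp_neg_sq_dist_ballMeasure {d : ℕ} (hd : Module.finrank ℝ E = 2 * d) (R : ℝ)
    {c : ℝ} (hc : 0 < c) :
    ∫ p, Real.exp (-‖p.1 - p.2‖ ^ 2 / c ^ 2) ∂((ballMeasure E R).prod (ballMeasure E R)) =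
      c ^ (2 * d) * ∫ p, (Metric.ball (0 : E) R).indicator (fun _ => (1 : ℝ)) (p.1 + c • p.2)
        ∂((ballMeasure E R).prod (gaussianWeight E)) := by
  have hB : MeasurableSet (Metric.ball (0 : E) R) := Metric.isOpen_ball.measurableSet
  have hmeas : Measurable fun p : E × E =>
      (Metric.ball (0 : E) R).indicator (fun _ => (1 : ℝ)) (p.1 + c • p.2) :=
    (measurable_const.indicator hB).comp (by fun_prop)
  rw [integral_prod, integral_prod, ← integral_const_mul]
  · congr 1
    ext x
    have h1 : ∫ y, Real.exp (-‖x - y‖ ^ 2 / c ^ 2) ∂(ballMeasure E R) =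
        ∫ y, (Metric.ball (0 : E) R).indicator
          (fun y => Real.exp (-‖x - y‖ ^ 2 / c ^ 2)) y := by
      rw [ballMeasure, integral_indicator hB]
    -- Substitution `y = x + c • u`, first the translation and then the dilation.
    rw [h1, ← integral_add_left_eq_self _ x, integral_gaussianWeight]
    have h2 := Measure.integral_comp_smul (volume : Measure E) (fun z =>
      (Metric.ball (0 : E) R).indicator (fun y => Real.exp (-‖x - y‖ ^ 2 / c ^ 2)) (x + z)) c
    rw [hd, abs_of_pos (by positivity), smul_eq_mul, eq_inv_mul_iff_mul_eq₀ (by positivity)] at h2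
    rw [← h2]
    congr 2
    ext u
    by_cases hu : x + c • u ∈ Metric.ball (0 : E) R
    · rw [Set.indicator_of_mem hu, Set.indicator_of_mem hu, mul_one]
      congr 1
      rw [sub_add_cancel_left, norm_neg, norm_smul, Real.norm_of_nonneg hc.le, mul_pow]
      field_simp
    · rw [Set.indicator_of_notMem hu, Set.indicator_of_notMem hu, mul_zero]
  · refine Integrable.of_bound hmeas.aestronglyMeasurable 1
      (Filter.Eventually.of_forall fun p => ?_)
    refine (norm_indicator_le_norm_self _ _).trans (by simp)
  · refine Integrable.of_bound (Continuous.aestronglyMeasurable (by fun_prop)) 1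
      (Filter.Eventually.of_forall fun p => ?_)
    rw [Real.norm_of_nonneg (Real.exp_nonneg _), Real.exp_le_one_iff]
    exact div_nonpos_of_nonpos_of_nonneg (by simp) (by positivity)

/-- The ball is open, so a point of it stays inside under a small enough shift `c • u`; dominated
convergence then leaves the volume times the Gaussian mass `π^d`. -/
theorem tendsto_integral_indicator_ball (R : ℝ) {d : ℕ} (hd : Module.finrank ℝ E = 2 * d)
    {c : ℕ → ℝ} (hc : Filter.Tendsto c Filter.atTop (nhds 0)) :
    Filter.Tendsto (fun n => ∫ p,
      (Metric.ball (0 : E) R).indicator (fun _ => (1 : ℝ)) (p.1 + c n • p.2)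
        ∂((ballMeasure E R).prod (gaussianWeight E))) Filter.atTop
      (nhds (volume.real (Metric.ball (0 : E) R) * Real.pi ^ d)) := by
  have hB : MeasurableSet (Metric.ball (0 : E) R) := Metric.isOpen_ball.measurableSet
  have hγ1 : (gaussianWeight E).real Set.univ = Real.pi ^ d := by
    have := integral_inner_pow_gaussianWeight hd (0 : E) 0
    simpa [expSqCoeff] using this
  have hlim : volume.real (Metric.ball (0 : E) R) * Real.pi ^ d =
      ∫ _, (1 : ℝ) ∂((ballMeasure E R).prod (gaussianWeight E)) := by
    rw [integral_const, smul_eq_mul, mul_one, ← Set.univ_prod_univ, measureReal_prod_prod, hγ1]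
    congr 1
    simp [ballMeasure]
  rw [hlim]
  refine tendsto_integral_of_dominated_convergence (fun _ => (1 : ℝ)) (fun n => ?_)
    (integrable_const _) (fun n => Filter.Eventually.of_forall fun p => ?_) ?_
  · exact ((measurable_const.indicator hB).comp
      (by fun_prop : Measurable fun p : E × E => p.1 + c n • p.2)).aestronglyMeasurable
  · refine (norm_indicator_le_norm_self _ _).trans (by simp)
  · have hae : ∀ᵐ x ∂(ballMeasure E R), x ∈ Metric.ball (0 : E) R := ae_restrict_mem hB
    filter_upwards [Measure.quasiMeasurePreserving_fst.ae hae] with p hp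
    have ht : Filter.Tendsto (fun n => p.1 + c n • p.2) Filter.atTop (nhds p.1) := by
      simpa using tendsto_const_nhds.add (hc.smul_const p.2)
    refine tendsto_const_nhds.congr' ?_
    filter_upwards [ht.eventually (Metric.isOpen_ball.mem_nhds hp)] with n hn
    rw [Set.indicator_of_mem (Metric.mem_ball.2 hn)]

/-- Plancherel's identity for the indicator function of a ball. -/
theorem integrable_and_integral_sq_norm_ballFourier {d : ℕ} (hd : Module.finrank ℝ E = 2 * d)
    (R : ℝ) :
    Integrable (fun k : E => ‖ballFourier R k‖ ^ 2) ∧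
      ∫ k : E, ‖ballFourier R k‖ ^ 2 =
        (2 * Real.pi) ^ (2 * d) * volume.real (Metric.ball (0 : E) R) := by
  set c : ℕ → ℝ := fun n => 1 / ((n : ℝ) + 1) with hcdef
  have hc0 : ∀ n, 0 < c n := fun n => by positivity
  have hc : Filter.Tendsto c Filter.atTop (nhds 0) := tendsto_one_div_add_atTop_nhds_zero_nat
  -- Chosen so that `4b = c²`; then `(π/b)^d c^(2d) = (4π)^d` does not depend on `n`.
  set b : ℕ → ℝ := fun n => c n ^ 2 / 4 with hbdef
  have hb0 : ∀ n, 0 < b n := fun n => by have := hc0 n; positivity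
  have hb : Filter.Tendsto b Filter.atTop (nhds 0) := by
    simpa using (hc.pow 2).div_const 4
  have hanti : Antitone b := by
    intro m n hmn
    have : c n ≤ c m := one_div_le_one_div_of_le (by positivity) (by exact_mod_cast by omega)
    have := hc0 n
    simp only [hbdef]
    gcongr
  set f : ℕ → E → ℝ := fun n k => Real.exp (-b n * ‖k‖ ^ 2) * ‖ballFourier R k‖ ^ 2 with hf
  have hfi : ∀ n, Integrable (f n) := fun n => integrable_gaussian_mul_ballFourier R (hb0 n)
  have hval : ∀ n, ∫ k, f n k = (4 * Real.pi) ^ d * ∫ p,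
      (Metric.ball (0 : E) R).indicator (fun _ => (1 : ℝ)) (p.1 + c n • p.2)
        ∂((ballMeasure E R).prod (gaussianWeight E)) := by
    intro n
    rw [hf, integral_gaussian_mul_ballFourier hd R (hb0 n)]
    have : 4 * b n = c n ^ 2 := by simp only [hbdef]; ring
    rw [this, integral_exp_neg_sq_dist_ballMeasure hd R (hc0 n), ← mul_assoc]
    congr 1
    rw [pow_mul, ← mul_pow, ← this]
    congr 1
    have := (hb0 n).ne'
    field_simp
  have hint : Filter.Tendsto (fun n => ∫ k, f n k) Filter.atTop
      (nhds ((2 * Real.pi) ^ (2 * d) * volume.real (Metric.ball (0 : E) R))) := by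
    simp only [hval]
    convert (tendsto_integral_indicator_ball (E := E) R hd hc).const_mul ((4 * Real.pi) ^ d) using 2
    rw [pow_mul, mul_comm (volume.real _), ← mul_assoc, ← mul_pow]
    congr 2
    ring
  have hf0 : ∀ n k, 0 ≤ f n k := fun n k => by positivity
  have hpt : ∀ k, Filter.Tendsto (fun n => f n k) Filter.atTop
      (nhds (‖ballFourier R k‖ ^ 2)) := by
    intro k
    have : Filter.Tendsto (fun n => Real.exp (-b n * ‖k‖ ^ 2)) Filter.atTop (nhds 1) := by
      have h := (hb.neg.mul_const (‖k‖ ^ 2)).rexp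
      simpa using h
    simpa [hf] using this.mul_const (‖ballFourier R k‖ ^ 2)
  have hmono : ∀ k, Monotone fun n => f n k := by
    intro k m n hmn
    have := hanti hmn
    simp only [hf]
    gcongr
  -- Monotone convergence in `ENNReal` gives integrability of the limit together with its integral.
  have hl : Filter.Tendsto (fun n => ∫⁻ k, ENNReal.ofReal (f n k)) Filter.atTop
      (nhds (∫⁻ k : E, ENNReal.ofReal (‖ballFourier R k‖ ^ 2))) :=
    lintegral_tendsto_of_tendsto_of_monotone
      (fun n => (hfi n).aestronglyMeasurable.aemeasurable.ennreal_ofReal)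
      (Filter.Eventually.of_forall fun k m n hmn => ENNReal.ofReal_le_ofReal (hmono k hmn))
      (Filter.Eventually.of_forall fun k => ENNReal.tendsto_ofReal (hpt k))
  have hl' : Filter.Tendsto (fun n => ∫⁻ k, ENNReal.ofReal (f n k)) Filter.atTop
      (nhds (ENNReal.ofReal ((2 * Real.pi) ^ (2 * d) *
        volume.real (Metric.ball (0 : E) R)))) := by
    refine (ENNReal.tendsto_ofReal hint).congr fun n => ?_
    rw [ofReal_integral_eq_lintegral_ofReal (hfi n) (Filter.Eventually.of_forall (hf0 n))]
  have heq := tendsto_nhds_unique hl hl'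
  have hmeas : AEStronglyMeasurable (fun k : E => ‖ballFourier R k‖ ^ 2) :=
    aestronglyMeasurable_of_tendsto_ae Filter.atTop (fun n => (hfi n).aestronglyMeasurable)
      (Filter.Eventually.of_forall hpt)
  have hnn : 0 ≤ᵐ[volume] fun k : E => ‖ballFourier R k‖ ^ 2 :=
    Filter.Eventually.of_forall fun k => by positivity
  refine ⟨⟨hmeas, ?_⟩, ?_⟩
  · rw [hasFiniteIntegral_iff_ofReal hnn, heq]
    exact ENNReal.ofReal_lt_top
  · rw [integral_eq_lintegral_of_nonneg_ae hnn hmeas, heq, ENNReal.toReal_ofReal (by positivity)]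

end BallPlancherel

/-! ### From the double Gaussian integral to the Bessel integral -/

section BallVariance

variable {E : Type*} [NormedAddCommGroup E] [InnerProductSpace ℝ E] [FiniteDimensional ℝ E]
  [MeasurableSpace E] [BorelSpace E]

theorem volume_real_ball_of_even_dim {d : ℕ} (hd : Module.finrank ℝ E = 2 * d) (hd1 : 1 ≤ d)
    {R : ℝ} (hR : 0 < R) :
    volume.real (Metric.ball (0 : E) R) = R ^ (2 * d) * (Real.pi ^ d / d.factorial) := by
  have : Nontrivial E := Module.nontrivial_of_finrank_pos (R := ℝ) (by omega)
  rw [measureReal_def, InnerProductSpace.volume_ball_of_dim_even hd, hd, ENNReal.toReal_mul,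
    ENNReal.toReal_pow, ENNReal.toReal_ofReal hR.le, ENNReal.toReal_ofReal (by positivity)]

variable (E) in
-- Subtract the weighted identity at `b = 1/4` from Plancherel; the integrand is radial, so polar
-- coordinates apply to both integrability and value.
theorem integrable_and_integral_besselJ {d : ℕ} (hd : Module.finrank ℝ E = 2 * d) (hd1 : 1 ≤ d)
    {R : ℝ} (hR : 0 < R) :
    IntegrableOn (fun κ : ℝ => besselJ d (κ * R) ^ 2 / κ * (1 - Real.exp (-κ ^ 2 / 4)))
      (Set.Ioi 0) ∧
    volume.real (Metric.ball (0 : E) R) / Real.pi ^ d -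
        (∫ p, Real.exp (-‖p.1 - p.2‖ ^ 2) ∂((ballMeasure E R).prod (ballMeasure E R))) /
          Real.pi ^ (2 * d) =
      2 * R ^ (2 * d) / (d - 1).factorial * ∫ κ in Set.Ioi (0 : ℝ),
        besselJ d (κ * R) ^ 2 / κ * (1 - Real.exp (-κ ^ 2 / 4)) := by
  have : Nontrivial E := Module.nontrivial_of_finrank_pos (R := ℝ) (by omega)
  obtain ⟨hi, hv⟩ := integrable_and_integral_sq_norm_ballFourier hd R (E := E)
  have hi2 := integrable_gaussian_mul_ballFourier (E := E) R (b := 1 / 4) (by norm_num)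
  have hv2 := integral_gaussian_mul_ballFourier hd R (b := 1 / 4) (by norm_num)
  set g : ℝ → ℝ := fun κ =>
    (Real.pi ^ d * R ^ (2 * d) * (2 / (κ * R)) ^ d * besselJ d (κ * R)) ^ 2 *
      (1 - Real.exp (-κ ^ 2 / 4)) with hg
  have hae : (fun k : E => ‖ballFourier R k‖ ^ 2 -
      Real.exp (-(1 / 4) * ‖k‖ ^ 2) * ‖ballFourier R k‖ ^ 2) =ᵐ[volume] fun k => g ‖k‖ := by
    have h0 : ∀ᵐ k : E, k ≠ 0 := by simp [ae_iff]
    filter_upwards [h0] with k hk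
    rw [ballFourier_eq_besselJ hd hR hk, Complex.norm_real, Real.norm_eq_abs, sq_abs, hg]
    simp only
    rw [show -(1 / 4) * ‖k‖ ^ 2 = -‖k‖ ^ 2 / 4 by ring]
    ring
  have hgi : Integrable fun k : E => g ‖k‖ := (hi.sub hi2).congr hae
  have hgv := integral_congr_ae hae
  rw [integral_sub hi hi2, hv, hv2, integral_fun_norm_addHaar,
    volume_real_ball_of_even_dim hd hd1 one_pos, hd] at hgv
  rw [integrable_fun_norm_addHaar, hd] at hgi
  -- The Jacobian `κ^(2d-1)` meets the factor `κ^(-2d)` of `|F|²` and leaves `1/κ`.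
  have hpt : ∀ κ ∈ Set.Ioi (0 : ℝ), κ ^ (2 * d - 1) • g κ =
      ((2 * Real.pi) ^ (2 * d) * R ^ (2 * d)) *
        (besselJ d (κ * R) ^ 2 / κ * (1 - Real.exp (-κ ^ 2 / 4))) := by
    intro κ hκ
    have hκ' : (0 : ℝ) < κ := hκ
    have h1 : κ ^ (2 * d) = κ ^ (2 * d - 1) * κ := by
      rw [← pow_succ]; congr 1; omega
    have h2 : (2 / (κ * R)) ^ d * (2 / (κ * R)) ^ d = 2 ^ (2 * d) / (κ ^ (2 * d) * R ^ (2 * d)) := by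
      rw [← pow_add, ← two_mul, div_pow, mul_pow]
    have h3 : Real.pi ^ d * Real.pi ^ d = Real.pi ^ (2 * d) := by rw [← pow_add, ← two_mul]
    calc κ ^ (2 * d - 1) • g κ = κ ^ (2 * d - 1) * (Real.pi ^ d * Real.pi ^ d) *
          (R ^ (2 * d) * R ^ (2 * d)) * ((2 / (κ * R)) ^ d * (2 / (κ * R)) ^ d) *
          besselJ d (κ * R) ^ 2 * (1 - Real.exp (-κ ^ 2 / 4)) := by
          simp only [hg, smul_eq_mul]; ring
      _ = _ := by
          rw [h2, h3, h1, mul_pow]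
          field_simp
  have hC : (2 * Real.pi) ^ (2 * d) * R ^ (2 * d) ≠ 0 := by positivity
  refine ⟨?_, ?_⟩
  · have := hgi.congr_fun hpt measurableSet_Ioi
    rwa [IntegrableOn, integrable_const_mul_iff (IsUnit.mk0 _ hC)] at this
  · rw [setIntegral_congr_fun measurableSet_Ioi hpt, integral_const_mul] at hgv
    set I := ∫ κ in Set.Ioi (0 : ℝ), besselJ d (κ * R) ^ 2 / κ * (1 - Real.exp (-κ ^ 2 / 4))
    have hexp : ∀ p : E × E, Real.exp (-‖p.1 - p.2‖ ^ 2 / (4 * (1 / 4))) =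
        Real.exp (-‖p.1 - p.2‖ ^ 2) := fun p => by norm_num
    simp only [hexp] at hgv
    set J := ∫ p, Real.exp (-‖p.1 - p.2‖ ^ 2) ∂((ballMeasure E R).prod (ballMeasure E R))
    set V := volume.real (Metric.ball (0 : E) R)
    -- The sphere has area `2d · π^d/d! = 2π^d/(d-1)!`, the origin of `(d - 1)!` in the formula.
    have hfac : (d.factorial : ℝ) = d * (d - 1).factorial := by
      exact_mod_cast (Nat.mul_factorial_pred (by omega)).symm
    have hd0 : (d : ℝ) ≠ 0 := by positivity
    have hf0 : ((d - 1).factorial : ℝ) ≠ 0 := by positivity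
    have e1 : (Real.pi / (1 / 4)) ^ d = 2 ^ (2 * d) * Real.pi ^ d := by
      rw [pow_mul, ← mul_pow]; congr 1; norm_num; ring
    have e2 : (2 * Real.pi) ^ (2 * d) = 2 ^ (2 * d) * (Real.pi ^ d * Real.pi ^ d) := by
      rw [mul_pow, ← pow_add, ← two_mul]
    have e3 : Real.pi ^ (2 * d) = Real.pi ^ d * Real.pi ^ d := by rw [← pow_add, ← two_mul]
    rw [e1, e2] at hgv
    simp only [smul_eq_mul, nsmul_eq_mul, one_pow, hfac] at hgv
    push_cast at hgv
    rw [e3]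
    have hp : Real.pi ^ d ≠ 0 := by positivity
    have h2 : (2 : ℝ) ^ (2 * d) ≠ 0 := by positivity
    field_simp at hgv ⊢
    linear_combination hgv

end BallVariance

/-! ### Counting points and tuples in a simple configuration -/

section SimpleConfigurations

variable {S : Type*} [MeasurableSpace S]

theorem measure_sum_dirac_eq_encard {ι : Type*} (f : ι → S) {s : Set S} (hs : MeasurableSet s) :
    Measure.sum (fun i => Measure.dirac (f i)) s = ({i | f i ∈ s}.encard : ENNReal) := by
  rw [Measure.sum_apply _ hs, ← ENNReal.tsum_set_one,
    tsum_subtype {i | f i ∈ s} fun _ => (1 : ENNReal)]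
  congr 1
  ext i
  rw [Measure.dirac_apply' _ hs]
  rfl

variable [MetricSpace S]

/-- The points of a simple configuration lying in a set, counted with multiplicity. -/
theorem measure_eq_encard_pointIndex [MeasurableSingletonClass S] {ξ : Measure S}
    (hξ : IsConfiguration ξ) (hs : ∀ x, ξ {x} = 0 ∨ ξ {x} = 1) {B : Set S}
    (hB : MeasurableSet B) :
    ξ B = ({p : PointIndex ξ | p.1.1 ∈ B}.encard : ENNReal) := by
  obtain ⟨⟨I, x, hx⟩, -⟩ := hξ
  have hcard : ∀ y, ξ {y} = ({i : I | x i = y}.encard : ENNReal) := fun y => by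
    conv_lhs => rw [hx]
    rw [measure_sum_dirac_eq_encard _ (measurableSet_singleton y)]
    rfl
  have hpos : ∀ i : I, ((0 : ℕ) : ENNReal) < ξ {x i} := by
    intro i
    rw [hcard, Nat.cast_zero, pos_iff_ne_zero]
    simp only [ne_eq, ENat.toENNReal_eq_zero, Set.encard_eq_zero]
    exact Set.Nonempty.ne_empty ⟨i, rfl⟩
  -- Simplicity allows at most one index per site.
  have hinj : Function.Injective fun i : I => x i := by
    intro i j hij
    have h1 : {k : I | x k = x j}.encard ≤ 1 := by
      have := hcard (x j)
      rcases hs (x j) with h | h <;> rw [h] at this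
      · have h0 : {k : I | x k = x j}.encard = 0 := by exact_mod_cast this.symm
        rw [h0]; exact zero_le_one
      · exact le_of_eq (by exact_mod_cast this.symm)
    exact Set.encard_le_one_iff.1 h1 i j hij rfl
  have hsum : ξ B = ({i : I | x i ∈ B}.encard : ENNReal) := by
    conv_lhs => rw [hx]
    exact measure_sum_dirac_eq_encard _ hB
  rw [hsum]
  congr 1
  -- At multiplicity one the only admissible second coordinate is `0`, so `F` reaches every point
  -- index.
  let F : I → PointIndex ξ := fun i => ⟨(x i, 0), hpos i⟩
  have hF : Function.Injective F := fun i j h => hinj (congrArg (fun p => p.1.1) h)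
  rw [← hF.encard_image]
  congr 1
  ext p
  constructor
  · rintro ⟨i, hi, rfl⟩
    exact hi
  · intro hp
    obtain ⟨⟨y, m⟩, hm⟩ := p
    have hy : ξ {y} ≠ 0 := (pos_of_gt hm).ne'
    have hm0 : m = 0 := by
      have h1 : ξ {y} = 1 := (hs y).resolve_left hy
      simp only [h1] at hm
      exact Nat.lt_one_iff.1 (by exact_mod_cast hm)
    subst hm0
    have hne : {i : I | x i = y}.Nonempty := by
      rw [Set.nonempty_iff_ne_empty]
      intro h
      rw [hcard, h] at hy
      simp at hy
    obtain ⟨i, rfl⟩ := hne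
    exact ⟨i, hp, rfl⟩

/-- On a cube, the factorial measure of a simple configuration counts injections. -/
theorem exists_factorialMeasure_eq_descFactorial [MeasurableSingletonClass S] {ξ : Measure S}
    (hξ : IsConfiguration ξ) (hs : ∀ x, ξ {x} = 0 ∨ ξ {x} = 1) {B : Set S}
    (hB : MeasurableSet B) (hbd : IsBounded B) :
    ∃ N : ℕ, ξ B = N ∧
      ∀ n, factorialMeasure ξ n (Set.univ.pi fun _ => B) = (N.descFactorial n : ENNReal) := by
  set T : Set (PointIndex ξ) := {p | p.1.1 ∈ B} with hT
  have hT1 : ξ B = (T.encard : ENNReal) := measure_eq_encard_pointIndex hξ hs hB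
  have hfin : T.Finite := by
    rw [← Set.encard_lt_top_iff, ← ENat.toENNReal_lt_top, ← hT1]
    exact hξ.2 B hbd
  have : Fintype T := hfin.fintype
  refine ⟨Fintype.card T, ?_, fun n => ?_⟩
  · rw [hT1, ← Set.coe_fintypeCard, ENat.toENNReal_coe]
  · have hpi : MeasurableSet (Set.univ.pi fun _ : Fin n => B) :=
      MeasurableSet.univ_pi fun _ => hB
    rw [factorialMeasure, Measure.sum_apply _ hpi]
    have h1 : ∀ i : {i : Fin n → PointIndex ξ // Function.Injective i},
        Measure.dirac (fun j => (i.1 j).1.1) (Set.univ.pi fun _ : Fin n => B) =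
          {i : {i : Fin n → PointIndex ξ // Function.Injective i} | ∀ j, i.1 j ∈ T}.indicator
            (fun _ => (1 : ENNReal)) i := by
      intro i
      rw [Measure.dirac_apply' _ hpi]
      by_cases h : ∀ j, i.1 j ∈ T
      · have hm : (fun j => (i.1 j).1.1) ∈ Set.univ.pi fun _ : Fin n => B := Set.mem_univ_pi.2 h
        exact (Set.indicator_of_mem hm _).trans (Set.indicator_of_mem (s := {i | _}) h _).symm
      · have hm : (fun j => (i.1 j).1.1) ∉ Set.univ.pi fun _ : Fin n => B :=
          fun h' => h (Set.mem_univ_pi.1 h')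
        exact (Set.indicator_of_notMem hm _).trans
          (Set.indicator_of_notMem (s := {i | _}) h _).symm
    simp only [h1]
    rw [← tsum_subtype, ENNReal.tsum_set_one]
    -- Injective tuples with values in `T` are embeddings `Fin n ↪ T`, whose number is the
    -- descending factorial.
    let e : {i : {i : Fin n → PointIndex ξ // Function.Injective i} | ∀ j, i.1 j ∈ T} ≃
        (Fin n ↪ T) :=
      { toFun := fun i => ⟨fun j => ⟨i.1.1 j, i.2 j⟩, fun a b h =>
          i.1.2 (congrArg Subtype.val h)⟩
        invFun := fun f => ⟨⟨fun j => (f j).1, fun a b h => f.injective (Subtype.ext h)⟩,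
          fun j => (f j).2⟩
        left_inv := fun i => rfl
        right_inv := fun f => rfl }
    rw [Set.encard, ENat.card_congr e, ENat.card_eq_coe_fintype_card, Fintype.card_embedding_eq,
      Fintype.card_fin, ENat.toENNReal_coe]

end SimpleConfigurations

/-! ### Factorial moments from correlation functions -/

section FactorialMoments

variable {Ω S : Type*} [MeasurableSpace Ω] [MetricSpace S] [ProperSpace S] [MeasurableSpace S]
  {P : Measure Ω} {Ξ : Ω → Measure S} {lam : Measure S}

/-- Makes indicators of cubes admissible test functions; properness makes the closure of `B`
compact. -/
theorem isBoundedCompactlySupported_indicator_pi {B : Set S} (hB : MeasurableSet B)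
    (hbd : IsBounded B) (n : ℕ) :
    IsBoundedCompactlySupported
      ((Set.univ.pi fun _ : Fin n => B).indicator fun _ => (1 : ℂ)) where
  measurable := measurable_const.indicator (MeasurableSet.univ_pi fun _ => hB)
  bounded := ⟨1, fun x => (norm_indicator_le_norm_self _ _).trans (by simp)⟩
  hasCompactSupport := by
    refine HasCompactSupport.intro
      (isCompact_univ_pi fun _ : Fin n => hbd.isCompact_closure) fun x hx => ?_
    exact Set.indicator_of_notMem
      (fun h => hx (Set.mem_univ_pi.2 fun i => subset_closure (Set.mem_univ_pi.1 h i))) _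

/-- Factorial moments of the number of points of a simple point process in a bounded set. -/
theorem IsCorrelationFunction.factorial_moment [MeasurableSingletonClass S] {n : ℕ} {ρ : (Fin n → S) → ℝ}
    (h : IsCorrelationFunction P Ξ lam n ρ) (hΞ : IsSimplePointProcess P Ξ) {B : Set S}
    (hB : MeasurableSet B) (hbd : IsBounded B) :
    Integrable (fun ω => ((descPochhammer ℝ n).eval (Ξ ω B).toReal)) P ∧
      ∫ ω, (descPochhammer ℝ n).eval (Ξ ω B).toReal ∂P =
        ∫ x in Set.univ.pi fun _ => B, ρ x ∂(Measure.pi fun _ : Fin n => lam) := by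
  have hφ := isBoundedCompactlySupported_indicator_pi hB hbd n
  have hpi : MeasurableSet (Set.univ.pi fun _ : Fin n => B) := MeasurableSet.univ_pi fun _ => hB
  -- `descPochhammer` extends the descending factorial to a polynomial, so it can be evaluated at
  -- the real-valued count.
  have hae : ∀ᵐ ω ∂P, ∫ x, (Set.univ.pi fun _ : Fin n => B).indicator (fun _ => (1 : ℂ)) x
      ∂(factorialMeasure (Ξ ω) n) = (((descPochhammer ℝ n).eval (Ξ ω B).toReal : ℝ) : ℂ) := by
    filter_upwards [hΞ.1.isConfiguration, hΞ.2] with ω h1 h2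
    obtain ⟨N, hN, hn⟩ := exists_factorialMeasure_eq_descFactorial h1 h2 hB hbd
    rw [integral_indicator_const _ hpi, measureReal_def, hn, hN, ENNReal.toReal_natCast,
      ENNReal.toReal_natCast, descPochhammer_eval_eq_descFactorial]
    simp
  have hint := (h.integrable_left _ hφ).congr hae
  have heq := h.integral_eq _ hφ
  rw [integral_congr_ae hae, integral_complex_ofReal] at heq
  have hr : ∀ x, (Set.univ.pi fun _ : Fin n => B).indicator (fun _ => (1 : ℂ)) x * (ρ x : ℂ) =
      (((Set.univ.pi fun _ : Fin n => B).indicator ρ x : ℝ) : ℂ) := by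
    intro x
    by_cases hx : x ∈ Set.univ.pi fun _ : Fin n => B
    · rw [Set.indicator_of_mem hx, Set.indicator_of_mem hx, one_mul]
    · rw [Set.indicator_of_notMem hx, Set.indicator_of_notMem hx, zero_mul, Complex.ofReal_zero]
  simp only [hr] at heq
  rw [integral_complex_ofReal, integral_indicator hpi] at heq
  exact ⟨by simpa using hint.re, by exact_mod_cast heq⟩

end FactorialMoments

/-! ### Correlations and structure factor of the Heisenberg process -/

section Heisenberg

variable {D : ℕ}

theorem heisenbergKernel_eq_exp_inner (x y : EuclideanSpace ℂ (Fin D)) :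
    heisenbergKernel D x y = Complex.exp (inner ℂ y x) := by
  simp [heisenbergKernel, PiLp.inner_apply, RCLike.inner_apply]

theorem heisenbergKernel_self (x : EuclideanSpace ℂ (Fin D)) :
    heisenbergKernel D x x = ((Real.exp (‖x‖ ^ 2) : ℝ) : ℂ) := by
  rw [heisenbergKernel_eq_exp_inner, inner_self_eq_norm_sq_to_K]
  simp

/-- The two factors are complex conjugates, so the product is `exp(2 Re ⟪x, y⟫)`; polarization
rewrites the exponent through `‖x - y‖²`. -/
theorem heisenbergKernel_mul_swap (x y : EuclideanSpace ℂ (Fin D)) :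
    heisenbergKernel D x y * heisenbergKernel D y x =
      ((Real.exp (‖x‖ ^ 2 + ‖y‖ ^ 2 - ‖x - y‖ ^ 2) : ℝ) : ℂ) := by
  have h : ‖x‖ ^ 2 + ‖y‖ ^ 2 - ‖x - y‖ ^ 2 = 2 * (inner ℂ x y : ℂ).re := by
    rw [norm_sub_sq (𝕜 := ℂ) x y]
    simp
  rw [heisenbergKernel_eq_exp_inner, heisenbergKernel_eq_exp_inner, ← Complex.exp_add, h,
    ← inner_conj_symm y x, add_comm, Complex.add_conj]
  push_cast
  rfl

theorem continuous_gaussianDensity : Continuous (gaussianDensity D) := by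
  unfold gaussianDensity
  fun_prop

theorem gaussianDensity_nonneg (x : EuclideanSpace ℂ (Fin D)) : 0 ≤ gaussianDensity D x := by
  unfold gaussianDensity
  positivity

theorem finrank_real_euclideanSpace_complex :
    Module.finrank ℝ (EuclideanSpace ℂ (Fin D)) = 2 * D := by
  rw [← Module.finrank_mul_finrank ℝ ℂ, Complex.finrank_real_complex, finrank_euclideanSpace,
    Fintype.card_fin]

variable {Ω : Type*} [MeasurableSpace Ω] {P : Measure Ω} {Ξ : Ω → Measure (EuclideanSpace ℂ (Fin D))}

/-- The one-point intensity of the Heisenberg process is the constant `π ^ (-D)`. -/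
theorem IsHeisenbergDPP.exists_correlation_one (hΞ : IsHeisenbergDPP P D Ξ) :
    ∃ ρ : (Fin 1 → EuclideanSpace ℂ (Fin D)) → ℝ,
      IsCorrelationFunction P Ξ (complexGaussian D) 1 ρ ∧
        ∀ x, ρ x * gaussianDensity D (x 0) = (Real.pi ^ D)⁻¹ := by
  obtain ⟨ρ, hρ, h⟩ := hΞ.correlation 1 le_rfl
  refine ⟨ρ, hρ, fun x => ?_⟩
  have h1 : ρ x = Real.exp (‖x 0‖ ^ 2) := by
    have := h x
    rw [Matrix.det_fin_one, Matrix.of_apply, heisenbergKernel_self] at this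
    exact_mod_cast this
  rw [h1, gaussianDensity, ← mul_div_assoc, ← Real.exp_add]
  simp

/-- The two-point intensity of the Heisenberg process. -/
theorem IsHeisenbergDPP.exists_correlation_two (hΞ : IsHeisenbergDPP P D Ξ) :
    ∃ ρ : (Fin 2 → EuclideanSpace ℂ (Fin D)) → ℝ,
      IsCorrelationFunction P Ξ (complexGaussian D) 2 ρ ∧
        ∀ x, ρ x * gaussianDensity D (x 0) * gaussianDensity D (x 1) =
          (Real.pi ^ D)⁻¹ ^ 2 * (1 - Real.exp (-‖x 0 - x 1‖ ^ 2)) := by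
  obtain ⟨ρ, hρ, h⟩ := hΞ.correlation 2 one_le_two
  refine ⟨ρ, hρ, fun x => ?_⟩
  have h1 : ρ x = Real.exp (‖x 0‖ ^ 2) * Real.exp (‖x 1‖ ^ 2) -
      Real.exp (‖x 0‖ ^ 2 + ‖x 1‖ ^ 2 - ‖x 0 - x 1‖ ^ 2) := by
    have := h x
    rw [Matrix.det_fin_two] at this
    simp only [Matrix.of_apply, heisenbergKernel_self, heisenbergKernel_mul_swap] at this
    exact_mod_cast this
  rw [h1, gaussianDensity, gaussianDensity, sub_eq_add_neg _ (‖x 0 - x 1‖ ^ 2), Real.exp_add,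
    Real.exp_add]
  simp only [Real.exp_neg]
  field_simp

/-- Take `C(x) = -exp(-‖x‖²)`. Its Fourier transform is `-π^D exp(-‖k‖²/4)`, and the intensity
`π^(-D)` removes the constant. -/
theorem IsHeisenbergDPP.hasStructureFactor (hΞ : IsHeisenbergDPP P D Ξ) :
    HasStructureFactor P Ξ (gaussianDensity D)
      (fun k => 1 - Complex.exp (-((‖k‖ : ℝ) : ℂ) ^ 2 / 4)) := by
  obtain ⟨ρ₁, hρ₁, h₁⟩ := hΞ.exists_correlation_one
  obtain ⟨ρ₂, hρ₂, h₂⟩ := hΞ.exists_correlation_two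
  have hint : ∀ b : ℝ, 0 < b →
      Integrable fun x : EuclideanSpace ℂ (Fin D) => Real.exp (-b * ‖x‖ ^ 2) := fun b hb => by
    simpa using integrable_exp_gaussian hb 0 (0 : EuclideanSpace ℂ (Fin D))
  have hcont : Continuous fun x : EuclideanSpace ℂ (Fin D) => -Real.exp (-‖x‖ ^ 2) := by fun_prop
  refine ⟨ρ₁, ρ₂, (Real.pi ^ D)⁻¹, fun x => -Real.exp (-‖x‖ ^ 2), hρ₁, hρ₂, fun x => h₁ ![x],
    fun x y => h₂ ![x, y], hcont.measurable, fun x => by simp, ?_, ?_, fun k => ?_⟩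
  · simpa using (hint 1 one_pos).neg
  · rw [memLp_two_iff_integrable_sq hcont.aestronglyMeasurable]
    refine (hint 2 two_pos).congr (Filter.Eventually.of_forall fun x => ?_)
    simp only [neg_sq, ← Real.exp_nat_mul]
    congr 1
    push_cast
    ring
  · have h := integral_cexp_gaussian_of_even_dim
      (finrank_real_euclideanSpace_complex (D := D)) one_pos Complex.I k
    have h' : ∀ x : EuclideanSpace ℂ (Fin D), Complex.exp (Complex.I * ((inner ℝ k x : ℝ) : ℂ)) *
        ((-Real.exp (-‖x‖ ^ 2) : ℝ) : ℂ) =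
        -Complex.exp (-((1 : ℝ) : ℂ) * ‖x‖ ^ 2 + Complex.I * (inner ℝ k x : ℝ)) := by
      intro x
      rw [Complex.exp_add]
      push_cast
      rw [neg_one_mul]
      ring
    simp only [h']
    rw [integral_neg, h, Complex.I_sq]
    have hp : (Real.pi : ℂ) ^ D ≠ 0 := pow_ne_zero _ (by exact_mod_cast Real.pi_ne_zero)
    push_cast
    rw [div_one, mul_one, neg_one_mul, mul_neg, inv_mul_cancel_left₀ hp]
    ring

theorem setIntegral_complexGaussian_pi_one {B : Set (EuclideanSpace ℂ (Fin D))}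
    (hB : MeasurableSet B) (ρ : (Fin 1 → EuclideanSpace ℂ (Fin D)) → ℝ) :
    ∫ x in Set.univ.pi fun _ => B, ρ x ∂(Measure.pi fun _ : Fin 1 => complexGaussian D) =
      ∫ x in B, ρ (fun _ => x) * gaussianDensity D x := by
  have : SigmaFinite (complexGaussian D) := SigmaFinite.withDensity_ofReal _
  have hm := measurePreserving_funUnique (complexGaussian D) (Fin 1)
  have h := hm.symm.setIntegral_preimage_emb (MeasurableEquiv.measurableEmbedding _) ρ
    (Set.univ.pi fun _ => B)
  refine Eq.trans (by convert h.symm) ?_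
  rw [complexGaussian]
  have hs : (MeasurableEquiv.funUnique (Fin 1) (EuclideanSpace ℂ (Fin D))).symm ⁻¹'
      (Set.univ.pi fun _ => B) = B := by
    ext x
    simp [MeasurableEquiv.funUnique]
  rw [hs, setIntegral_withDensity_eq_setIntegral_toReal_smul
    continuous_gaussianDensity.measurable.ennreal_ofReal (by simp) _ hB]
  refine setIntegral_congr_fun hB fun x _ => ?_
  simp only [ENNReal.toReal_ofReal (gaussianDensity_nonneg x), smul_eq_mul]
  rw [mul_comm]
  rfl

/-- Moves the Gaussian densities into the integrand, where they meet `ρ` and give the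
translation-invariant two-point intensity. -/
theorem setIntegral_complexGaussian_pi_two {B : Set (EuclideanSpace ℂ (Fin D))}
    (hB : MeasurableSet B) (ρ : (Fin 2 → EuclideanSpace ℂ (Fin D)) → ℝ) :
    ∫ x in Set.univ.pi fun _ => B, ρ x ∂(Measure.pi fun _ : Fin 2 => complexGaussian D) =
      ∫ p, ρ ![p.1, p.2] * gaussianDensity D p.1 * gaussianDensity D p.2
        ∂((volume.restrict B).prod (volume.restrict B)) := by
  have : SigmaFinite (complexGaussian D) := SigmaFinite.withDensity_ofReal _
  have hℓ : Measurable fun x => ENNReal.ofReal (gaussianDensity D x) :=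
    continuous_gaussianDensity.measurable.ennreal_ofReal
  have hm := measurePreserving_finTwoArrow (complexGaussian D)
  have h := hm.symm.setIntegral_preimage_emb (MeasurableEquiv.measurableEmbedding _) ρ
    (Set.univ.pi fun _ => B)
  have hs : (MeasurableEquiv.finTwoArrow (α := EuclideanSpace ℂ (Fin D))).symm ⁻¹'
      (Set.univ.pi fun _ => B) = B ×ˢ B := by
    ext x
    simp [MeasurableEquiv.finTwoArrow, Fin.forall_fin_two]
  have hℓ2 : Measurable fun p : EuclideanSpace ℂ (Fin D) × EuclideanSpace ℂ (Fin D) =>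
      ENNReal.ofReal (gaussianDensity D p.1) * ENNReal.ofReal (gaussianDensity D p.2) :=
    (hℓ.comp measurable_fst).mul (hℓ.comp measurable_snd)
  rw [← h, hs, complexGaussian, prod_withDensity hℓ hℓ,
    setIntegral_withDensity_eq_setIntegral_toReal_smul hℓ2
      (Filter.Eventually.of_forall fun p => ENNReal.mul_lt_top ENNReal.ofReal_lt_top
        ENNReal.ofReal_lt_top) _ (hB.prod hB), Measure.prod_restrict]
  refine setIntegral_congr_fun (hB.prod hB) fun p _ => ?_
  simp only [ENNReal.toReal_mul, ENNReal.toReal_ofReal (gaussianDensity_nonneg _), smul_eq_mul]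
  rw [mul_comm, mul_assoc]
  rfl

end Heisenberg

/-! ### Mean and variance of the number of points in a ball -/

theorem proposition3p4 {Ω : Type*} [MeasurableSpace Ω] (P : Measure Ω) [IsProbabilityMeasure P]
    (D : ℕ) (hD : 1 ≤ D) (Ξ : Ω → Measure (EuclideanSpace ℂ (Fin D)))
    (hΞ : IsHeisenbergDPP P D Ξ) :
    HasStructureFactor P Ξ (gaussianDensity D)
      (fun k => 1 - Complex.exp (-((‖k‖ : ℝ) : ℂ) ^ 2 / 4)) ∧
    ∀ R : ℝ, 0 < R →
      MemLp (fun ω => (Ξ ω (Metric.ball 0 R)).toReal) 2 P ∧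
      ∫ ω, (Ξ ω (Metric.ball 0 R)).toReal ∂P = R ^ (2 * D) / D.factorial ∧
      IntegrableOn
        (fun κ : ℝ => besselJ D (κ * R) ^ 2 / κ * (1 - Real.exp (-κ ^ 2 / 4))) (Set.Ioi 0) ∧
      variance (fun ω => (Ξ ω (Metric.ball 0 R)).toReal) P =
        2 * R ^ (2 * D) / (D - 1).factorial *
          ∫ κ in Set.Ioi (0 : ℝ),
            besselJ D (κ * R) ^ 2 / κ * (1 - Real.exp (-κ ^ 2 / 4)) := by
  refine ⟨hΞ.hasStructureFactor, fun R hR => ?_⟩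
  have hB : MeasurableSet (Metric.ball (0 : EuclideanSpace ℂ (Fin D)) R) :=
    Metric.isOpen_ball.measurableSet
  have hdim := finrank_real_euclideanSpace_complex (D := D)
  obtain ⟨ρ₁, hρ₁, h₁⟩ := hΞ.exists_correlation_one
  obtain ⟨ρ₂, hρ₂, h₂⟩ := hΞ.exists_correlation_two
  obtain ⟨i₁, e₁⟩ := hρ₁.factorial_moment hΞ.simple hB Metric.isBounded_ball
  obtain ⟨i₂, e₂⟩ := hρ₂.factorial_moment hΞ.simple hB Metric.isBounded_ball
  obtain ⟨hI, hvar⟩ := integrable_and_integral_besselJ (EuclideanSpace ℂ (Fin D)) hdim hD hR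
  rw [setIntegral_complexGaussian_pi_one hB] at e₁
  rw [setIntegral_complexGaussian_pi_two hB] at e₂
  set N : Ω → ℝ := fun ω => (Ξ ω (Metric.ball 0 R)).toReal with hN
  have hp1 : ∀ ω, (descPochhammer ℝ 1).eval (N ω) = N ω := fun ω => by simp
  have hp2 : ∀ ω, (descPochhammer ℝ 2).eval (N ω) = N ω ^ 2 - N ω := fun ω => by
    rw [descPochhammer_succ_right]
    simp
    ring
  change Integrable (fun ω => (descPochhammer ℝ 1).eval (N ω)) P at i₁
  change Integrable (fun ω => (descPochhammer ℝ 2).eval (N ω)) P at i₂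
  change ∫ ω, (descPochhammer ℝ 1).eval (N ω) ∂P = _ at e₁
  change ∫ ω, (descPochhammer ℝ 2).eval (N ω) ∂P = _ at e₂
  simp only [hp1, hp2] at i₁ i₂ e₁ e₂
  have e₁' : ∫ ω, N ω ∂P = volume.real (Metric.ball (0 : EuclideanSpace ℂ (Fin D)) R) /
      Real.pi ^ D := by
    rw [e₁, setIntegral_congr_fun hB fun x _ => h₁ fun _ => x, setIntegral_const, smul_eq_mul]
    rfl
  -- `N² = N(N-1) + N`, and both factorial moments are finite.
  have hsq : Integrable (fun ω => N ω ^ 2) P := by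
    refine (i₂.add i₁).congr (Filter.Eventually.of_forall fun ω => ?_)
    simp
  have hmem : MemLp N 2 P := (memLp_two_iff_integrable_sq i₁.aestronglyMeasurable).2 hsq
  have e₂' : ∫ ω, N ω ^ 2 ∂P - ∫ ω, N ω ∂P = (Real.pi ^ D)⁻¹ ^ 2 *
      (volume.real (Metric.ball (0 : EuclideanSpace ℂ (Fin D)) R) ^ 2 -
        ∫ p, Real.exp (-‖p.1 - p.2‖ ^ 2) ∂((ballMeasure (EuclideanSpace ℂ (Fin D)) R).prod
          (ballMeasure (EuclideanSpace ℂ (Fin D)) R))) := by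
    rw [← integral_sub hsq i₁, e₂]
    have h₂' : ∀ p : EuclideanSpace ℂ (Fin D) × EuclideanSpace ℂ (Fin D),
        ρ₂ ![p.1, p.2] * gaussianDensity D p.1 * gaussianDensity D p.2 =
          (Real.pi ^ D)⁻¹ ^ 2 * (1 - Real.exp (-‖p.1 - p.2‖ ^ 2)) := fun p => h₂ ![p.1, p.2]
    simp only [h₂']
    rw [integral_const_mul]
    congr 1
    change ∫ p, 1 - Real.exp (-‖p.1 - p.2‖ ^ 2) ∂((ballMeasure (EuclideanSpace ℂ (Fin D)) R).prod
          (ballMeasure (EuclideanSpace ℂ (Fin D)) R)) = _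
    rw [integral_sub (integrable_const _), integral_const, ← Set.univ_prod_univ,
      measureReal_prod_prod, smul_eq_mul, mul_one, sq]
    · simp [ballMeasure]
    · refine Integrable.of_bound (Continuous.aestronglyMeasurable (by fun_prop)) 1
        (Filter.Eventually.of_forall fun p => ?_)
      rw [Real.norm_of_nonneg (Real.exp_nonneg _), Real.exp_le_one_iff]
      simp
  refine ⟨hmem, ?_, hI, ?_⟩
  · rw [e₁', volume_real_ball_of_even_dim hdim hD hR]
    field_simp
  · rw [← hvar, variance_eq_sub hmem]
    simp only [Pi.pow_apply]
    -- In `E[N(N-1)] + E N - (E N)²` the terms `V²/π^(2D)` cancel.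
    rw [eq_add_of_sub_eq e₂', e₁', pow_mul']
    field_simp
    ring
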